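/- Let $r\ge 1$ be an integer and let $u_1,\dots,u_r,d,q\in\mathbb C$ with $|q|<1$ and $du_kq^n\neq 1$ for all $1\le k\le r$, $n\ge 0$. For $1\le j<2^r$ and $1\le k\le r$ let $\epsilon_k(j)=1$ if $2^{k-1}$ appears in the binary expansion of $j$ and $\epsilon_k(j)=0$ otherwise; put $\tilde u_j=u_1^{\epsilon_1(j)}\cdots u_r^{\epsilon_r(j)}$ and $w(\tilde u_j)=\epsilon_1(j)+\cdots+\epsilon_r(j)$. Let $$\begin{bmatrix} m\\ s\end{bmatrix}_q=\frac{(1-q^m)(1-q^{m-1})\cdots(1-q^{m-s+1})}{(1-q)(1-q^2)\cdots(1-q^s)}\ \text{ if } 0\le s\le m,\qquad \begin{bmatrix} m\\ s\end{bmatrix}_q=0\ \text{ otherwise},$$ and $(a;q)_\infty=\prod_{n\ge 0}(1-aq^n)$. Let $D\subseteq\mathbb C$ contain $0$ and $1$ and satisfy $qD\subseteq D$, and let $f:D\to\mathbb C$ be continuous at $0$ (for instance, given by a convergent power series near $0$), with $f(0)=1$, and such that for all $x\in D$ the $q$-difference equation of order $r$ $$\prod_{i=1}^{r}(1-dxu_i)\,f(x)=f(xq)+\sum_{i=1}^{r}\Biggl(\sum_{m=0}^{r-i}d^m\sum_{\substack{1\le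 j<2^r\\ w(\tilde u_j)=i+m}}x\,\tilde u_j\Bigl((-x)^{m-1}\begin{bmatrix} i+m-1\\ m-1\end{bmatrix}_q+(-x)^m\begin{bmatrix} i+m\\ m\end{bmatrix}_q\Bigr)\Biggr)\prod_{h=1}^{i-1}(1-xq^h)\,f(xq^i)$$ holds (for $m=0$ the term with $(-x)^{m-1}$ is read as $0$). Then $$f(1)=\prod_{k=1}^{r}\frac{(-u_k;q)_\infty}{(du_k;q)_\infty}.$$ -/

import Mathlib

/-- The exponent `ε_k(j)`, for `k ≥ 1`: it is `1` if `2^(k-1)` appears in the binary expansion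
of `j`, and `0` otherwise. -/
def colourExp (k j : ℕ) : ℕ := if j.testBit (k - 1) then 1 else 0

/-- The colour `ũ_j = u_1^{ε_1(j)} ⋯ u_r^{ε_r(j)}` as a monomial in the primary colours
`u_1, …, u_r` (only the values `u k` with `1 ≤ k ≤ r` matter). -/
def colour (r : ℕ) (u : ℕ → ℂ) (j : ℕ) : ℂ := ∏ k ∈ Finset.Icc 1 r, u k ^ colourExp k j

/-- The weight `w(ũ_j)`: the number of primary colours among `u_1, …, u_r` appearing in `ũ_j`. -/
def colourWeight (r j : ℕ) : ℕ := ((Finset.Icc 1 r).filter (fun k => colourExp k j = 1)).card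

/-- The `q`-binomial coefficient
`(1 - q^m)(1 - q^(m-1)) ⋯ (1 - q^(m-s+1)) / ((1 - q)(1 - q^2) ⋯ (1 - q^s))` if `0 ≤ s ≤ m`,
and `0` otherwise; the arguments are integers, so that `s = -1` gives `0`. -/
noncomputable def qBinomial (q : ℂ) (m s : ℤ) : ℂ :=
  if 0 ≤ s ∧ s ≤ m then
    (∏ t ∈ Finset.range s.toNat, (1 - q ^ (m.toNat - t))) /
      ∏ t ∈ Finset.range s.toNat, (1 - q ^ (t + 1))
  else 0

/-- The infinite `q`-Pochhammer symbol `(a;q)_∞ = ∏_{n ≥ 0} (1 - a q^n)`, for `|q| < 1`. -/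
noncomputable def qPochhammerInf (a q : ℂ) : ℂ := ∏' n : ℕ, (1 - a * q ^ n)

/-- The infinite product that defines `(a;q)_∞` converges when `|q| < 1`. -/
theorem multipliable_qPochhammerInf (a q : ℂ) (hq : ‖q‖ < 1) :
    Multipliable (fun n : ℕ => 1 - a * q ^ n) := by
  have h : Summable (fun n : ℕ => ‖-(a * q ^ n)‖) := by
    simpa [norm_mul, norm_pow] using
      (summable_geometric_of_lt_one (norm_nonneg q) hq).mul_left ‖a‖
  simpa [sub_eq_add_neg] using multipliable_one_add_of_summable h

/-- The order-`r` `q`-difference equation for `f` at every point `x` of `D`: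
`∏_{i=1}^r (1 - d x u_i) f(x) = f(xq) + ∑_{i=1}^r (∑_{m=0}^{r-i} d^m ∑_{1 ≤ j < 2^r, w(ũ_j) = i+m}`
`x ũ_j ((-x)^{m-1} [i+m-1, m-1]_q + (-x)^m [i+m, m]_q)) ∏_{h=1}^{i-1} (1 - x q^h) f(x q^i)`.
The term with `(-x)^{m-1}` vanishes for `m = 0`, its `q`-binomial coefficient being `0`. -/
def QDiffEq (r : ℕ) (u : ℕ → ℂ) (d q : ℂ) (D : Set ℂ) (f : ℂ → ℂ) : Prop :=
  ∀ x ∈ D,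
    (∏ i ∈ Finset.Icc 1 r, (1 - d * x * u i)) * f x =
      f (x * q) +
        ∑ i ∈ Finset.Icc 1 r,
          (∑ m ∈ Finset.range (r - i + 1),
            d ^ m *
              ∑ j ∈ (Finset.Ico 1 (2 ^ r)).filter (fun j => colourWeight r j = i + m),
                x * colour r u j *
                  ((-x) ^ ((m : ℤ) - 1) * qBinomial q ((i : ℤ) + m - 1) ((m : ℤ) - 1) +
                    (-x) ^ m * qBinomial q ((i : ℤ) + m) (m : ℤ))) *
            (∏ h ∈ Finset.Icc 1 (i - 1), (1 - x * q ^ h)) * f (x * q ^ i)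

open Polynomial Filter Topology

/-! ### Operators on sequences -/

/-! Put a_n = f(q^n), let S be the shift and Q multiplication by q^n, and set W = (1 - Q)S - dQ and
E(w) = ∏ (1 + u_k w). Expanding powers of W by the noncommutative q-binomial theorem shows that the
equation of order r, along the powers of q, is a - Sa = Q(S + d)((E - 1)/w)(W) a
(`seqQDiff_of_qDiffEq`). This form is stable: E(W)a satisfies the same equation with E(qw) in place
of E(w) (`SeqQDiff.step`). After K steps the polynomial is E(q^K w), which tends to 1, so the K-th
sequence has total variation O(|q|^K), and its entry at 0 and its limit at infinity agree up to that
error. Both ends are explicit. At n = 0 the factor 1 - q^n vanishes and W acts as the scalar -d,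
giving ∏ E(-d q^k) f(1). As n tends to infinity W becomes the shift, giving ∏ E(q^k) f(0). Letting K
grow (`tendsto_prod_eval`) yields the quotient of infinite products. -/

/-- The shift `a ↦ (n ↦ a (n + 1))`. -/
def seqShift : Module.End ℂ (ℕ → ℂ) := LinearMap.funLeft ℂ ℂ Nat.succ

/-- Multiplication of a sequence by `n ↦ q ^ n`. -/
def seqMulPow (q : ℂ) : Module.End ℂ (ℕ → ℂ) := LinearMap.mulLeft ℂ (fun n : ℕ => q ^ n)

/-- The operator `a ↦ (n ↦ (1 - α q ^ n) a (n + 1) - β q ^ n a n)`. -/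
def seqOp (q α β : ℂ) : Module.End ℂ (ℕ → ℂ) :=
  (1 - α • seqMulPow q) * seqShift - β • seqMulPow q

/-- The operator `a ↦ (n ↦ a (n + 1) + d * a n)`. -/
def seqShiftAdd (d : ℂ) : Module.End ℂ (ℕ → ℂ) := seqShift + d • 1

@[simp] lemma seqShift_apply (a : ℕ → ℂ) (n : ℕ) : seqShift a n = a (n + 1) := rfl

@[simp] lemma seqMulPow_apply (q : ℂ) (a : ℕ → ℂ) (n : ℕ) : seqMulPow q a n = q ^ n * a n := rfl

@[simp] lemma seqOp_apply (q α β : ℂ) (a : ℕ → ℂ) (n : ℕ) :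
    seqOp q α β a n = (1 - α * q ^ n) * a (n + 1) - β * q ^ n * a n := by
  simp [seqOp]; ring

@[simp] lemma seqShiftAdd_apply (d : ℂ) (a : ℕ → ℂ) (n : ℕ) :
    seqShiftAdd d a n = a (n + 1) + d * a n := by
  simp [seqShiftAdd]

lemma aeval_mul_of_intertwine {A : Type*} [Ring A] [Algebra ℂ A] {a b t : A}
    (h : a * t = t * b) (p : ℂ[X]) : aeval a p * t = t * aeval b p := by
  induction p using Polynomial.induction_on' with
  | add p q hp hq => simp [add_mul, mul_add, hp, hq]
  | monomial n c =>
    have key : a ^ n * t = t * b ^ n := (show SemiconjBy t b a from h.symm).pow_right n |>.symm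
    simp only [aeval_monomial]
    rw [mul_assoc, key, ← mul_assoc, ← mul_assoc, Algebra.commutes]

/-- Together with the next two relations, this carries N = `seqOp q q (d * q)` past S, where it
becomes W, and past Q(S + d), where it becomes qW. -/
lemma seqShiftAdd_mul_seqOp (q d : ℂ) :
    seqOp q q d * seqShiftAdd d = seqShiftAdd d * seqOp q 1 d := by
  ext a n
  simp; ring

lemma seqShift_mul_seqOp (q d : ℂ) :
    seqOp q q (d * q) * seqShift = seqShift * seqOp q 1 d := by
  ext a n
  simp; ring

lemma seqOp_mul_seqMulPow (q d : ℂ) :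
    seqOp q q (d * q) * seqMulPow q = seqMulPow q * (q • seqOp q q d) := by
  ext a n
  simp; ring

lemma aeval_comp_C_mul_X {A : Type*} [Ring A] [Algebra ℂ A] (a : A) (q : ℂ) (p : ℂ[X]) :
    aeval a (p.comp (C q * X)) = aeval (q • a) p := by
  rw [aeval_comp]; simp [Algebra.smul_def]

/-- Since N = W + (1 - q)Q(S + d), and N picks up a factor q when it crosses Q(S + d), the
coefficients obey (1 - q) + q(1 - q^(k+1)) = 1 - q^(k+2). -/
lemma seqOp_pow_succ (q d : ℂ) (k : ℕ) :
    seqOp q q (d * q) ^ (k + 1) = seqOp q 1 d ^ (k + 1) +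
      (1 - q ^ (k + 1)) • (seqMulPow q * seqShiftAdd d * seqOp q 1 d ^ k) := by
  have h1 : seqOp q q (d * q) = seqOp q 1 d + (1 - q) • (seqMulPow q * seqShiftAdd d) := by
    ext a n
    simp; ring
  induction k with
  | zero => simpa using h1
  | succ k ih =>
    have h2 : seqOp q q (d * q) * (seqMulPow q * seqShiftAdd d * seqOp q 1 d ^ k) =
        q • (seqMulPow q * seqShiftAdd d * seqOp q 1 d ^ (k + 1)) := by
      rw [← mul_assoc, ← mul_assoc, seqOp_mul_seqMulPow, mul_assoc (seqMulPow q), smul_mul_assoc,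
        seqShiftAdd_mul_seqOp, pow_succ']
      simp [mul_assoc]
    rw [pow_succ', ih, mul_add, mul_smul_comm, h2, h1, add_mul, ← pow_succ', smul_mul_assoc,
      smul_smul, add_assoc, ← add_smul]
    congr 2
    ring

/-- Linear extension of the formula for powers: the factors 1 - q^(k+1) assemble into the
q-derivative (p(w) - p(qw))/w. -/
lemma aeval_seqOp_sub (q d : ℂ) (p : ℂ[X]) :
    aeval (seqOp q q (d * q)) p = aeval (seqOp q 1 d) p +
      seqMulPow q * seqShiftAdd d * aeval (seqOp q 1 d) (divX (p - p.comp (C q * X))) := by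
  induction p using Polynomial.induction_on' with
  | add p p' hp hp' =>
    rw [map_add, map_add, hp, hp', add_comp, add_sub_add_comm, divX_add, map_add, mul_add]
    abel
  | monomial n c =>
    cases n with
    | zero => simp
    | succ k =>
      have : divX (monomial (k + 1) c - (monomial (k + 1) c).comp (C q * X)) =
          C (c * (1 - q ^ (k + 1))) * X ^ k := by
        have : monomial (k + 1) c - (monomial (k + 1) c).comp (C q * X) =
            (C (c * (1 - q ^ (k + 1))) * X ^ k) * X := by
          rw [monomial_comp, ← C_mul_X_pow_eq_monomial]
          simp only [map_mul, map_sub, map_pow, map_one]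
          ring
        rw [this]
        ext n
        simp [coeff_divX]
      rw [this]
      simp only [aeval_monomial, seqOp_pow_succ, map_mul, aeval_C, map_pow, aeval_X, mul_add,
        ← Algebra.smul_def, smul_mul_assoc, mul_smul_comm, smul_smul]
      rw [mul_comm c]

/-- The `q`-difference equation attached to a polynomial `E`, along `n ↦ q ^ n`. -/
def SeqQDiff (q d : ℂ) (E : ℂ[X]) (a : ℕ → ℂ) : Prop :=
  a - seqShift a = seqMulPow q (seqShiftAdd d (aeval (seqOp q 1 d) (divX E) a))

/-- With F(w) = E(qw), both sides are (FE - E)/w. -/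
lemma divX_comp_identity (q : ℂ) (E : ℂ[X]) (hE : E.coeff 0 = 1) :
    E.comp (C q * X) * divX E - divX (E - E.comp (C q * X)) =
      divX (E.comp (C q * X)) * E := by
  set F := E.comp (C q * X) with hF
  have hF0 : F.coeff 0 = 1 := by
    rw [hF, coeff_zero_eq_eval_zero, eval_comp]
    simp [← coeff_zero_eq_eval_zero, hE]
  have h1 := divX_mul_X_add E
  have h2 := divX_mul_X_add F
  have h3 := divX_mul_X_add (E - F)
  rw [hE, map_one] at h1
  rw [hF0, map_one] at h2
  rw [coeff_sub, hE, hF0, sub_self, map_zero, add_zero] at h3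
  apply mul_right_cancel₀ (X_ne_zero (R := ℂ))
  linear_combination F * h1 - h3 - E * h2

/-- If `a` solves the equation for `E(w)`, then `E(W) a` solves the one for `E(q w)`. -/
lemma SeqQDiff.step {q d : ℂ} {E : ℂ[X]} {a : ℕ → ℂ} (hE : E.coeff 0 = 1)
    (ha : SeqQDiff q d E a) :
    SeqQDiff q d (E.comp (C q * X)) (aeval (seqOp q 1 d) E a) := by
  unfold SeqQDiff at *
  set W := seqOp q 1 d with hW
  set N := seqOp q q (d * q) with hN
  have hs : seqShift (aeval W E a) = aeval N E (seqShift a) :=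
    (LinearMap.congr_fun (aeval_mul_of_intertwine (seqShift_mul_seqOp q d) E) a).symm
  have hsub : aeval N E a = aeval W E a + seqMulPow q (seqShiftAdd d
      (aeval W (divX (E - E.comp (C q * X))) a)) :=
    LinearMap.congr_fun (aeval_seqOp_sub q d E) a
  have hX : ∀ b, aeval N E (seqMulPow q (seqShiftAdd d b)) =
      seqMulPow q (seqShiftAdd d (aeval W (E.comp (C q * X)) b)) := fun b => by
    have h1 := LinearMap.congr_fun (aeval_mul_of_intertwine (seqOp_mul_seqMulPow q d) E)
      (seqShiftAdd d b)
    have h2 := LinearMap.congr_fun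
      (aeval_mul_of_intertwine (seqShiftAdd_mul_seqOp q d) (E.comp (C q * X))) b
    rw [aeval_comp_C_mul_X] at h2
    simp only [Module.End.mul_apply] at h1 h2
    rw [h1, h2]
  have hid := congrArg (fun p => aeval W p a) (divX_comp_identity q E hE)
  simp only [map_sub, map_mul, LinearMap.sub_apply, Module.End.mul_apply] at hid
  -- E(W)a - S E(W)a = E(N)(a - Sa) - (E(N) - E(W))a; both terms have the form Q(S + d)(...), and
  -- the polynomial identity combines them.
  rw [hs, ← hid, map_sub, map_sub, ← hX, ← ha, map_sub, hsub]
  abel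

/-! ### Values, limits and bounds -/

lemma aeval_seqOp_apply_zero (q d : ℂ) (p : ℂ[X]) (a : ℕ → ℂ) :
    aeval (seqOp q 1 d) p a 0 = p.eval (-d) * a 0 := by
  have hk : ∀ k : ℕ, (seqOp q 1 d ^ k) a 0 = (-d) ^ k * a 0 := fun k => by
    induction k with
    | zero => simp
    | succ k ih => rw [pow_succ', Module.End.mul_apply, seqOp_apply, ih]; simp; ring
  induction p using Polynomial.induction_on' with
  | add p p' hp hp' => simp [add_mul, hp, hp']
  | monomial n c => simp [aeval_monomial, Algebra.algebraMap_eq_smul_one, hk, mul_assoc]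

lemma tendsto_aeval_seqOp {q : ℂ} (hq : ‖q‖ < 1) (d : ℂ) (p : ℂ[X]) {a : ℕ → ℂ} {l : ℂ}
    (ha : Tendsto a atTop (𝓝 l)) :
    Tendsto (aeval (seqOp q 1 d) p a) atTop (𝓝 (p.eval 1 * l)) := by
  have hk : ∀ k : ℕ, Tendsto ((seqOp q 1 d ^ k) a) atTop (𝓝 l) := fun k => by
    induction k with
    | zero => simpa using ha
    | succ k ih =>
      have hp := tendsto_pow_atTop_nhds_zero_of_norm_lt_one hq
      have h1 := ((tendsto_const_nhds (x := (1 : ℂ))).sub (hp.const_mul 1)).mul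
        ((tendsto_add_atTop_iff_nat 1).2 ih)
      have h2 := h1.sub ((hp.const_mul d).mul ih)
      rw [pow_succ', Module.End.mul_apply]
      convert h2 using 1
      · ext n; simp
      · simp
  induction p using Polynomial.induction_on' with
  | add p p' hp hp' =>
    simp only [map_add, eval_add, add_mul]
    exact hp.add hp'
  | monomial n c =>
    simp only [aeval_monomial, Algebra.algebraMap_eq_smul_one, eval_monomial, one_pow, mul_one,
      smul_mul_assoc, one_mul, LinearMap.smul_apply]
    exact (hk n).const_mul c

/-- The sum of `‖p_k‖ M ^ k` over the coefficients of `p`. -/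
noncomputable def coeffNorm (M : ℝ) (p : ℂ[X]) : ℝ := p.sum fun k c => ‖c‖ * M ^ k

/-- In the sup norm W has norm at most 2 + ‖d‖, because |1 - q^n| ≤ 2 and |q^n| ≤ 1. -/
lemma norm_seqOp_pow_le {q : ℂ} (hq : ‖q‖ < 1) (d : ℂ) {a : ℕ → ℂ} {A : ℝ}
    (ha : ∀ n, ‖a n‖ ≤ A) (k n : ℕ) :
    ‖(seqOp q 1 d ^ k) a n‖ ≤ (2 + ‖d‖) ^ k * A := by
  induction k generalizing n with
  | zero => simpa using ha n
  | succ k ih =>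
    rw [pow_succ', Module.End.mul_apply, seqOp_apply, one_mul]
    have hqn : ‖q ^ n‖ ≤ 1 := by rw [norm_pow]; exact pow_le_one₀ (norm_nonneg _) hq.le
    have h1 : ‖1 - q ^ n‖ ≤ 2 := (norm_sub_le _ _).trans (by rw [norm_one]; linarith)
    have h2 : ‖d * q ^ n‖ ≤ ‖d‖ := by
      rw [norm_mul]; exact mul_le_of_le_one_right (norm_nonneg _) hqn
    calc _ ≤ ‖(1 - q ^ n) * (seqOp q 1 d ^ k) a (n + 1)‖
          + ‖d * q ^ n * (seqOp q 1 d ^ k) a n‖ := norm_sub_le _ _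
      _ ≤ 2 * ((2 + ‖d‖) ^ k * A) + ‖d‖ * ((2 + ‖d‖) ^ k * A) := by
          rw [norm_mul, norm_mul]
          gcongr
          · exact ih _
          · exact ih _
      _ = _ := by ring

lemma norm_aeval_seqOp_le {q : ℂ} (hq : ‖q‖ < 1) (d : ℂ) {a : ℕ → ℂ} {A : ℝ}
    (ha : ∀ n, ‖a n‖ ≤ A) (p : ℂ[X]) (n : ℕ) :
    ‖aeval (seqOp q 1 d) p a n‖ ≤ coeffNorm (2 + ‖d‖) p * A := by
  rw [aeval_eq_sum_range, coeffNorm, sum_over_range _ (by simp), Finset.sum_mul]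
  simp only [LinearMap.sum_apply, Finset.sum_apply, LinearMap.smul_apply, Pi.smul_apply,
    smul_eq_mul]
  refine (norm_sum_le _ _).trans (Finset.sum_le_sum fun k _ => ?_)
  rw [norm_mul, mul_assoc]
  gcongr
  exact norm_seqOp_pow_le hq d ha k n

lemma coeffNorm_eq_sum {M : ℝ} {p : ℂ[X]} {N : ℕ} (h : p.natDegree < N) :
    coeffNorm M p = ∑ k ∈ Finset.range N, ‖p.coeff k‖ * M ^ k :=
  sum_over_range' _ (by simp) _ h

lemma natDegree_comp_C_mul_X_le (p : ℂ[X]) (c : ℂ) :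
    (p.comp (C c * X)).natDegree ≤ p.natDegree := by
  refine natDegree_comp_le.trans ?_
  exact (Nat.mul_le_mul_left _ ((natDegree_C_mul_le c X).trans natDegree_X_le)).trans (mul_one _).le

/-- Removing the constant term leaves at least one factor c in every coefficient; with c = q^K this
is the source of the decay in K. -/
lemma coeffNorm_divX_comp_le {M : ℝ} (hM : 1 ≤ M) (p : ℂ[X]) {c : ℂ} (hc : ‖c‖ ≤ 1) :
    coeffNorm M (divX (p.comp (C c * X))) ≤ ‖c‖ * coeffNorm M p := by
  have hd : (divX (p.comp (C c * X))).natDegree < p.natDegree + 1 := by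
    rw [natDegree_divX_eq_natDegree_tsub_one]
    have := natDegree_comp_C_mul_X_le p c
    omega
  rw [coeffNorm_eq_sum hd, coeffNorm_eq_sum (p := p) (N := p.natDegree + 2) (by omega),
    Finset.sum_range_succ' _ (p.natDegree + 1), mul_add, Finset.mul_sum]
  refine le_add_of_le_of_nonneg (Finset.sum_le_sum fun k _ => ?_) (by positivity)
  rw [coeff_divX, comp_C_mul_X_coeff, norm_mul, norm_pow]
  have h1 : ‖c‖ ^ (k + 1) ≤ ‖c‖ := pow_le_of_le_one (norm_nonneg _) hc (by omega)
  have h2 : M ^ k ≤ M ^ (k + 1) := pow_le_pow_right₀ hM (by omega)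
  calc _ ≤ ‖p.coeff (k + 1)‖ * ‖c‖ * M ^ (k + 1) := by gcongr
    _ = _ := by ring

lemma coeffNorm_nonneg {M : ℝ} (hM : 0 ≤ M) (p : ℂ[X]) : 0 ≤ coeffNorm M p :=
  Finset.sum_nonneg fun _ _ => by positivity

lemma coeffNorm_comp_le {M : ℝ} (hM : 1 ≤ M) {p : ℂ[X]} (hp : p.coeff 0 = 1) {c : ℂ}
    (hc : ‖c‖ ≤ 1) : coeffNorm M (p.comp (C c * X)) ≤ 1 + ‖c‖ * coeffNorm M p := by
  rw [coeffNorm_eq_sum (Nat.lt_succ_of_le (natDegree_comp_C_mul_X_le p c)),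
    coeffNorm_eq_sum (p := p) (Nat.lt_succ_self _), Finset.sum_range_succ',
    Finset.sum_range_succ', add_comm, mul_add, Finset.mul_sum]
  simp only [comp_C_mul_X_coeff, hp]
  simp only [pow_zero, mul_one, norm_one, norm_mul, norm_pow]
  refine add_le_add le_rfl (le_add_of_le_of_nonneg (Finset.sum_le_sum fun k _ => ?_) (norm_nonneg _))
  have h1 : ‖c‖ ^ (k + 1) ≤ ‖c‖ := pow_le_of_le_one (norm_nonneg _) hc (by omega)
  calc _ ≤ ‖p.coeff (k + 1)‖ * ‖c‖ * M ^ (k + 1) := by gcongr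
    _ = _ := by ring

/-! ### Iterating the step -/

/-- The sequence `E(q^(K-1) W) ⋯ E(q W) E(W) a`. -/
noncomputable def iterSeq (q d : ℂ) (E : ℂ[X]) (a : ℕ → ℂ) : ℕ → ℕ → ℂ
  | 0 => a
  | K + 1 => aeval (seqOp q 1 d) (E.comp (C (q ^ K) * X)) (iterSeq q d E a K)

lemma iterSeq_apply_zero (q d : ℂ) (E : ℂ[X]) (a : ℕ → ℂ) (K : ℕ) :
    iterSeq q d E a K 0 = (∏ k ∈ Finset.range K, E.eval (-d * q ^ k)) * a 0 := by
  induction K with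
  | zero => simp [iterSeq]
  | succ K ih =>
    rw [iterSeq, aeval_seqOp_apply_zero, ih, Finset.prod_range_succ, eval_comp]
    simp only [eval_mul, eval_C, eval_X, mul_comm (-d)]
    ring

lemma tendsto_iterSeq {q : ℂ} (hq : ‖q‖ < 1) (d : ℂ) (E : ℂ[X]) {a : ℕ → ℂ} {l : ℂ}
    (ha : Tendsto a atTop (𝓝 l)) (K : ℕ) :
    Tendsto (iterSeq q d E a K) atTop (𝓝 ((∏ k ∈ Finset.range K, E.eval (q ^ k)) * l)) := by
  induction K with
  | zero => simpa [iterSeq] using ha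
  | succ K ih =>
    have h := tendsto_aeval_seqOp hq d (E.comp (C (q ^ K) * X)) ih
    rw [eval_comp, eval_mul, eval_C, eval_X, mul_one] at h
    rw [iterSeq, Finset.prod_range_succ]
    convert h using 2
    ring

lemma seqQDiff_iterSeq {q d : ℂ} {E : ℂ[X]} {a : ℕ → ℂ} (hE : E.coeff 0 = 1)
    (ha : SeqQDiff q d E a) (K : ℕ) :
    SeqQDiff q d (E.comp (C (q ^ K) * X)) (iterSeq q d E a K) := by
  induction K with
  | zero => simpa [iterSeq] using ha
  | succ K ih =>
    have h := ih.step (by rw [comp_C_mul_X_coeff, hE, pow_zero, one_mul])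
    rw [iterSeq]
    convert h using 1
    rw [comp_assoc]
    congr 1
    simp [pow_succ, mul_assoc]

/-- Step K multiplies the bound by at most 1 + c|q|^K ≤ exp(c|q|^K). The exponents form a geometric
series, so the bound is uniform in K. -/
lemma norm_iterSeq_le {q : ℂ} (hq : ‖q‖ < 1) (d : ℂ) {E : ℂ[X]} {a : ℕ → ℂ} {A : ℝ}
    (hE : E.coeff 0 = 1) (ha : ∀ n, ‖a n‖ ≤ A) (K n : ℕ) :
    ‖iterSeq q d E a K n‖ ≤
      Real.exp (coeffNorm (2 + ‖d‖) E * ∑ k ∈ Finset.range K, ‖q‖ ^ k) * A := by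
  have hA : 0 ≤ A := (norm_nonneg _).trans (ha 0)
  induction K generalizing n with
  | zero => simpa [iterSeq] using ha n
  | succ K ih =>
    refine (norm_aeval_seqOp_le hq d ih _ n).trans ?_
    have hc : ‖q ^ K‖ ≤ 1 := by rw [norm_pow]; exact pow_le_one₀ (norm_nonneg _) hq.le
    have hM : 1 ≤ 2 + ‖d‖ := by linarith [norm_nonneg d]
    have h1 := coeffNorm_comp_le hM hE hc
    have h2 := Real.add_one_le_exp (‖q ^ K‖ * coeffNorm (2 + ‖d‖) E)
    rw [Finset.sum_range_succ, mul_add, Real.exp_add]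
    calc _ ≤ Real.exp (‖q ^ K‖ * coeffNorm (2 + ‖d‖) E) *
          (Real.exp (coeffNorm (2 + ‖d‖) E * ∑ k ∈ Finset.range K, ‖q‖ ^ k) * A) := by
          gcongr
          linarith
      _ = _ := by rw [norm_pow, mul_comm (‖q‖ ^ K)]; ring

lemma norm_iterSeq_sub_le {q : ℂ} (hq : ‖q‖ < 1) (d : ℂ) {E : ℂ[X]} {a : ℕ → ℂ} {l : ℂ}
    (hE : E.coeff 0 = 1) (ha : SeqQDiff q d E a) (hl : Tendsto a atTop (𝓝 l)) :
    ∃ B : ℝ, ∀ K : ℕ, ‖iterSeq q d E a K 0 - (∏ k ∈ Finset.range K, E.eval (q ^ k)) * l‖ ≤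
      B * ‖q‖ ^ K := by
  obtain ⟨A, hA⟩ := (Metric.isBounded_range_of_tendsto a hl).exists_norm_le
  replace hA : ∀ n, ‖a n‖ ≤ A := fun n => hA _ ⟨n, rfl⟩
  have hA0 : 0 ≤ A := (norm_nonneg _).trans (hA 0)
  set M := 2 + ‖d‖
  have hM : 1 ≤ M := by simp only [M]; linarith [norm_nonneg d]
  set c := coeffNorm M E
  have hc : 0 ≤ c := coeffNorm_nonneg (by linarith) E
  set A' := Real.exp (c * (1 - ‖q‖)⁻¹) * A
  have hA' : ∀ K n, ‖iterSeq q d E a K n‖ ≤ A' := fun K n => by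
    refine (norm_iterSeq_le hq d hE hA K n).trans ?_
    have : ∑ k ∈ Finset.range K, ‖q‖ ^ k ≤ (1 - ‖q‖)⁻¹ := by
      rw [← tsum_geometric_of_lt_one (norm_nonneg _) hq]
      exact (summable_geometric_of_lt_one (norm_nonneg _) hq).sum_le_tsum _
        fun _ _ => by positivity
    simp only [A']
    gcongr
  refine ⟨(1 + ‖d‖) * (c * A') / (1 - ‖q‖), fun K => ?_⟩
  have hqK : ‖q ^ K‖ ≤ 1 := by rw [norm_pow]; exact pow_le_one₀ (norm_nonneg _) hq.le
  have hb : ∀ n, ‖aeval (seqOp q 1 d) (divX (E.comp (C (q ^ K) * X))) (iterSeq q d E a K) n‖ ≤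
      ‖q‖ ^ K * c * A' := fun n => by
    refine (norm_aeval_seqOp_le hq d (hA' K) _ n).trans ?_
    have := coeffNorm_divX_comp_le hM E hqK
    rw [norm_pow] at this
    have hA0' : 0 ≤ A' := (norm_nonneg _).trans (hA' 0 0)
    gcongr
  -- The equation for E(q^K w) bounds each increment: Q supplies |q|^n and the polynomial supplies
  -- |q|^K. Summing over n gives the distance from entry 0 to the limit.
  have hstep : ∀ n, dist (iterSeq q d E a K n) (iterSeq q d E a K (n + 1)) ≤
      ((1 + ‖d‖) * (‖q‖ ^ K * c * A')) * ‖q‖ ^ n := fun n => by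
    have h := congrFun (seqQDiff_iterSeq hE ha K) n
    simp only [Pi.sub_apply, seqShift_apply, seqMulPow_apply, seqShiftAdd_apply] at h
    rw [dist_eq_norm, h, norm_mul, norm_pow, mul_comm]
    gcongr
    refine (norm_add_le _ _).trans ?_
    rw [norm_mul, add_mul, one_mul]
    gcongr
    · exact hb _
    · exact hb _
  have := dist_le_of_le_geometric_of_tendsto₀ _ _ hq hstep (tendsto_iterSeq hq d E hl K)
  rw [dist_eq_norm] at this
  refine this.trans (le_of_eq ?_)
  ring

lemma tendsto_prod_eval {q : ℂ} (hq : ‖q‖ < 1) (d : ℂ) {E : ℂ[X]} {a : ℕ → ℂ} {l : ℂ}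
    (hE : E.coeff 0 = 1) (ha : SeqQDiff q d E a) (hl : Tendsto a atTop (𝓝 l)) :
    Tendsto (fun K => (∏ k ∈ Finset.range K, E.eval (-d * q ^ k)) * a 0 -
      (∏ k ∈ Finset.range K, E.eval (q ^ k)) * l) atTop (𝓝 0) := by
  obtain ⟨B, hB⟩ := norm_iterSeq_sub_le hq d hE ha hl
  refine squeeze_zero_norm (a := fun K => B * ‖q‖ ^ K) (fun K => ?_) ?_
  · rw [← iterSeq_apply_zero]; exact hB K
  · simpa using (tendsto_pow_atTop_nhds_zero_of_lt_one (norm_nonneg q) hq).const_mul B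

/-! ### The `q`-difference equation along powers of `q` -/

lemma qBinomial_zero_right (q : ℂ) (k : ℕ) : qBinomial q k 0 = 1 := by
  simp [qBinomial]

lemma qBinomial_eq_zero (q : ℂ) {k m : ℕ} (h : k < m) : qBinomial q k m = 0 := by
  rw [qBinomial, if_neg]
  omega

lemma qBinomial_natCast (q : ℂ) {k m : ℕ} (h : m ≤ k) :
    qBinomial q k m = (∏ t ∈ Finset.range m, (1 - q ^ (k - t))) /
      ∏ t ∈ Finset.range m, (1 - q ^ (t + 1)) := by
  rw [qBinomial, if_pos (by omega), Int.toNat_natCast, Int.toNat_natCast]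

lemma one_sub_pow_ne_zero {q : ℂ} (hq : ‖q‖ < 1) (t : ℕ) : 1 - q ^ (t + 1) ≠ 0 := by
  intro h
  have h1 : ‖q ^ (t + 1)‖ < 1 := by
    rw [norm_pow]; exact pow_lt_one₀ (norm_nonneg _) hq (by omega)
  rw [← sub_eq_zero.1 h, norm_one] at h1
  exact lt_irrefl _ h1

lemma prod_one_sub_pow_ne_zero {q : ℂ} (hq : ‖q‖ < 1) (m : ℕ) :
    ∏ t ∈ Finset.range m, (1 - q ^ (t + 1)) ≠ 0 :=
  Finset.prod_ne_zero_iff.2 fun t _ => one_sub_pow_ne_zero hq t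

lemma qBinomial_self {q : ℂ} (hq : ‖q‖ < 1) (k : ℕ) : qBinomial q k k = 1 := by
  rw [qBinomial_natCast q le_rfl, div_eq_one_iff_eq (prod_one_sub_pow_ne_zero hq k),
    ← Finset.prod_range_reflect]
  refine Finset.prod_congr rfl fun t ht => ?_
  rw [Finset.mem_range] at ht
  congr 2
  omega

/-- Pascal's rule for the `q`-binomial coefficients. -/
lemma qBinomial_succ_succ {q : ℂ} (hq : ‖q‖ < 1) (k m : ℕ) :
    qBinomial q (k + 1 : ℕ) (m + 1 : ℕ) =
      q ^ (m + 1) * qBinomial q k (m + 1 : ℕ) + qBinomial q k m := by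
  rcases lt_trichotomy k m with h | rfl | h
  · rw [qBinomial_eq_zero q h, qBinomial_eq_zero q (by omega : k < m + 1),
      qBinomial_eq_zero q (by omega : k + 1 < m + 1)]
    simp
  · rw [qBinomial_self hq, qBinomial_self hq, qBinomial_eq_zero q (Nat.lt_succ_self k)]
    simp
  · obtain ⟨e, rfl⟩ := Nat.exists_eq_add_of_lt h
    rw [qBinomial_natCast q (by omega), qBinomial_natCast q (by omega),
      qBinomial_natCast q (by omega), Finset.prod_range_succ' (fun t => 1 - q ^ (m + e + 1 + 1 - t)),
      Finset.prod_range_succ (fun t => 1 - q ^ (t + 1)),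
      Finset.prod_range_succ (fun t => 1 - q ^ (m + e + 1 - t))]
    have h1 := prod_one_sub_pow_ne_zero hq m
    have h2 := one_sub_pow_ne_zero hq m
    have h3 : ∀ t, m + e + 1 + 1 - (t + 1) = m + e + 1 - t := fun t => by omega
    simp only [h3, Nat.sub_zero, show m + e + 1 - m = e + 1 by omega]
    field_simp
    ring

/-- The `q`-binomial theorem for `A + B` with `B A = q A B`. -/
lemma add_pow_of_q_commute {A : Type*} [Ring A] [Algebra ℂ A] {q : ℂ} (hq : ‖q‖ < 1) {a b : A}
    (h : b * a = q • (a * b)) (k : ℕ) :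
    (a + b) ^ k = ∑ m ∈ Finset.range (k + 1), qBinomial q k m • (a ^ m * b ^ (k - m)) := by
  have hc : ∀ m, b * a ^ m = q ^ m • (a ^ m * b) := fun m => by
    induction m with
    | zero => simp
    | succ m ih =>
      rw [pow_succ, ← mul_assoc, ih, smul_mul_assoc, mul_assoc, h, mul_smul_comm, smul_smul,
        ← pow_succ, mul_assoc]
  induction k with
  | zero => simp [qBinomial]
  | succ k ih =>
    have hb : b * ∑ m ∈ Finset.range (k + 1), qBinomial q k m • (a ^ m * b ^ (k - m)) =
        ∑ m ∈ Finset.range (k + 2), (q ^ m * qBinomial q k m) • (a ^ m * b ^ (k + 1 - m)) := by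
      rw [Finset.sum_range_succ _ (k + 1), qBinomial_eq_zero q (Nat.lt_succ_self k),
        Finset.mul_sum]
      simp only [mul_zero, zero_smul, add_zero]
      refine Finset.sum_congr rfl fun m hm => ?_
      rw [Finset.mem_range] at hm
      rw [mul_smul_comm, ← mul_assoc, hc, smul_mul_assoc, smul_smul, mul_assoc, ← pow_succ',
        mul_comm (q ^ m), show k - m + 1 = k + 1 - m by omega]
    rw [pow_succ', ih, add_mul, hb, Finset.sum_range_succ' _ (k + 1), Finset.mul_sum,
      Finset.sum_range_succ' _ (k + 1), ← add_assoc, ← Finset.sum_add_distrib]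
    congr 1
    · refine Finset.sum_congr rfl fun m _ => ?_
      rw [qBinomial_succ_succ hq, add_smul, add_comm, mul_smul_comm, ← mul_assoc, ← pow_succ',
        Nat.add_sub_add_right]
    · rw [Nat.cast_zero, qBinomial_zero_right, qBinomial_zero_right]
      simp

lemma seqMulPow_pow_apply (q : ℂ) (c : ℂ) (m : ℕ) (b : ℕ → ℂ) (n : ℕ) :
    ((c • seqMulPow q) ^ m) b n = (c * q ^ n) ^ m * b n := by
  induction m with
  | zero => simp
  | succ m ih => rw [pow_succ', Module.End.mul_apply]; simp [ih]; ring

lemma seqOp_zero_pow_succ_apply (q : ℂ) (a : ℕ → ℂ) (k n : ℕ) :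
    (seqOp q 1 0 ^ (k + 1)) a n = (1 - q ^ n) * (seqOp q 1 0 ^ k) a (n + 1) := by
  rw [pow_succ', Module.End.mul_apply]; simp

lemma seqOp_zero_pow_apply_succ (q : ℂ) (a : ℕ → ℂ) (k n : ℕ) :
    (seqOp q 1 0 ^ k) a (n + 1) =
      (∏ h ∈ Finset.Icc 1 k, (1 - q ^ n * q ^ h)) * a (n + (k + 1)) := by
  induction k generalizing n with
  | zero => simp
  | succ k ih =>
    have hI : ∀ g : ℕ → ℂ, ∏ h ∈ Finset.Icc 1 (k + 1), g h =
        g 1 * ∏ h ∈ Finset.Icc 1 k, g (h + 1) := fun g => by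
      clear ih
      induction k with
      | zero => simp
      | succ k ih =>
        rw [Finset.prod_Icc_succ_top (by omega), ih, Finset.prod_Icc_succ_top (by omega), mul_assoc]
    rw [seqOp_zero_pow_succ_apply, ih, hI, show n + 1 + (k + 1) = n + (k + 1 + 1) by omega,
      ← mul_assoc]
    simp only [pow_succ, mul_assoc, pow_zero, one_mul, mul_comm q]

/-- W is the sum of -dQ and W₀ = (1 - Q)S, which q-commute, so the q-binomial theorem applies. -/
lemma seqOp_pow_apply {q : ℂ} (hq : ‖q‖ < 1) (d : ℂ) (a : ℕ → ℂ) (k n : ℕ) :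
    (seqOp q 1 d ^ k) a n = ∑ i ∈ Finset.range (k + 1),
      qBinomial q k (k - i : ℕ) * (-d * q ^ n) ^ (k - i) * (seqOp q 1 0 ^ i) a n := by
  have h0 : seqOp q 1 d = (-d) • seqMulPow q + seqOp q 1 0 := by
    ext a n
    simp; ring
  have hc : seqOp q 1 0 * ((-d) • seqMulPow q) = q • (((-d) • seqMulPow q) * seqOp q 1 0) := by
    ext a n
    simp; ring
  rw [h0, add_pow_of_q_commute hq hc, ← Finset.sum_range_reflect]
  simp only [LinearMap.sum_apply, Finset.sum_apply, LinearMap.smul_apply, Pi.smul_apply,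
    Module.End.mul_apply, seqMulPow_pow_apply, smul_eq_mul]
  refine Finset.sum_congr rfl fun i hi => ?_
  rw [Finset.mem_range] at hi
  rw [show k + 1 - 1 - i = k - i by omega, show k - (k - i) = i by omega, mul_assoc]

/-- The coefficient of `f (x q^i)` coming from the colours of weight `i + m`. -/
noncomputable def qDiffCoeff (q d x : ℂ) (i m : ℕ) : ℂ :=
  d ^ m * (x * ((-x) ^ ((m : ℤ) - 1) * qBinomial q ((i : ℤ) + m - 1) ((m : ℤ) - 1) +
    (-x) ^ m * qBinomial q ((i : ℤ) + m) (m : ℤ)))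

lemma qDiffCoeff_zero (q d x : ℂ) (i : ℕ) : qDiffCoeff q d x i 0 = x := by
  have h : qBinomial q ((i : ℤ) + (0 : ℕ) - 1) (((0 : ℕ) : ℤ) - 1) = 0 := by
    rw [qBinomial, if_neg (by omega)]
  have h' : qBinomial q ((i : ℤ) + (0 : ℕ)) ((0 : ℕ) : ℤ) = 1 := by
    simpa using qBinomial_zero_right q i
  rw [qDiffCoeff, h, h']
  simp

/-- Pascal's rule splits the coefficient into the part coming from S W^k and the part coming from d
W^k. -/
lemma qDiffCoeff_succ {q : ℂ} (hq : ‖q‖ < 1) (d x : ℂ) (i m : ℕ) :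
    qDiffCoeff q d x i (m + 1) =
      qBinomial q (i + m : ℕ) (m + 1 : ℕ) * (-d * (x * q)) ^ (m + 1) * x +
      d * x * (1 - x) * (qBinomial q (i + m : ℕ) m * (-d * x) ^ m) := by
  have h := qBinomial_succ_succ hq (i + m) m
  have e1 : ((m + 1 : ℕ) : ℤ) - 1 = m := by push_cast; ring
  have e2 : (i : ℤ) + (m + 1 : ℕ) - 1 = (i + m : ℕ) := by push_cast; ring
  have e3 : (i : ℤ) + (m + 1 : ℕ) = (i + m + 1 : ℕ) := by push_cast; ring
  rw [qDiffCoeff, e1, e2, e3, h, zpow_natCast]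
  simp only [mul_pow, neg_mul, neg_pow x, neg_pow (d * (x * q)), neg_pow (d * x)]
  ring

/-- This is the weight k + 1 part of the q-difference equation; the subtracted term belongs to the
expansion of ∏ (1 - d x u_i). -/
lemma seqMulPow_seqShiftAdd_seqOp_pow {q : ℂ} (hq : ‖q‖ < 1) (d : ℂ) (a : ℕ → ℂ) (k n : ℕ) :
    q ^ n * ((seqOp q 1 d ^ k) a (n + 1) + d * (seqOp q 1 d ^ k) a n) =
      ∑ i ∈ Finset.range (k + 1), qDiffCoeff q d (q ^ n) (i + 1) (k - i) *
        ((∏ h ∈ Finset.Icc 1 i, (1 - q ^ n * q ^ h)) * a (n + (i + 1)))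
      - (-d * q ^ n) ^ (k + 1) * a n := by
  simp only [← seqOp_zero_pow_apply_succ]
  rw [seqOp_pow_apply hq, seqOp_pow_apply hq,
    Finset.sum_range_succ' (fun i => _ * (seqOp q 1 0 ^ i) a n)]
  rw [Finset.sum_range_succ, Finset.sum_range_succ, Nat.sub_self, Nat.sub_zero, qDiffCoeff_zero,
    qBinomial_self hq, Nat.cast_zero, qBinomial_zero_right, pow_zero, pow_zero]
  have key : ∀ i ∈ Finset.range k, qDiffCoeff q d (q ^ n) (i + 1) (k - i) *
      (seqOp q 1 0 ^ i) a (n + 1) =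
      q ^ n * (qBinomial q k (k - i : ℕ) * (-d * q ^ (n + 1)) ^ (k - i) *
        (seqOp q 1 0 ^ i) a (n + 1)) +
      q ^ n * d * (qBinomial q k (k - (i + 1) : ℕ) * (-d * q ^ n) ^ (k - (i + 1)) *
        (seqOp q 1 0 ^ (i + 1)) a n) := fun i hi => by
    obtain ⟨e, rfl⟩ := Nat.exists_eq_add_of_lt (Finset.mem_range.1 hi)
    rw [show i + e + 1 - i = e + 1 by omega, show i + e + 1 - (i + 1) = e by omega,
      qDiffCoeff_succ hq, seqOp_zero_pow_succ_apply, show i + 1 + e = i + e + 1 by omega, pow_succ q n]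
    ring
  rw [Finset.sum_congr rfl key, Finset.sum_add_distrib, ← Finset.mul_sum, ← Finset.mul_sum]
  simp only [Module.End.one_apply]
  ring

/-! ### Colours -/

lemma colourExp_le_one (k j : ℕ) : colourExp k j = 0 ∨ colourExp k j = 1 := by
  unfold colourExp; split_ifs <;> simp

lemma colourWeight_succ (r j : ℕ) :
    colourWeight (r + 1) j = colourWeight r j + colourExp (r + 1) j := by
  rw [colourWeight, colourWeight, ← Finset.insert_Icc_right_eq_Icc_add_one (by omega), Finset.filter_insert]
  rcases colourExp_le_one (r + 1) j with h | h
  · simp [h]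
  · rw [if_pos h, Finset.card_insert_of_notMem (by simp), h]

lemma colour_succ (r : ℕ) (u : ℕ → ℂ) (j : ℕ) :
    colour (r + 1) u j = colour r u j * u (r + 1) ^ colourExp (r + 1) j := by
  rw [colour, Finset.prod_Icc_succ_top (by omega), colour]

lemma colourExp_two_pow_add {r k : ℕ} (hk : k ∈ Finset.Icc 1 r) (j : ℕ) :
    colourExp k (2 ^ r + j) = colourExp k j := by
  rw [Finset.mem_Icc] at hk
  rw [colourExp, Nat.testBit_two_pow_add_gt (by omega), colourExp]

lemma colour_two_pow_add (r : ℕ) (u : ℕ → ℂ) (j : ℕ) :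
    colour r u (2 ^ r + j) = colour r u j :=
  Finset.prod_congr rfl fun k hk => by rw [colourExp_two_pow_add hk]

lemma colourWeight_two_pow_add (r j : ℕ) : colourWeight r (2 ^ r + j) = colourWeight r j := by
  rw [colourWeight, colourWeight]
  congr 1
  exact Finset.filter_congr fun k hk => by rw [colourExp_two_pow_add hk]

/-- The polynomial `∏_k (1 + u_k w)`. -/
noncomputable def colourPoly (r : ℕ) (u : ℕ → ℂ) : ℂ[X] := ∏ k ∈ Finset.Icc 1 r, (1 + C (u k) * X)

/-- Splitting the indices below 2^(r+1) by their top bit multiplies the sum by 1 + u_(r+1) w. -/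
lemma sum_colour (r : ℕ) (u : ℕ → ℂ) :
    ∑ j ∈ Finset.range (2 ^ r), C (colour r u j) * X ^ colourWeight r j = colourPoly r u := by
  induction r with
  | zero => simp [colour, colourWeight, colourPoly]
  | succ r ih =>
    have h0 : ∀ j ∈ Finset.range (2 ^ r), colourExp (r + 1) j = 0 := fun j hj => by
      rw [colourExp, Nat.add_sub_cancel, Nat.testBit_lt_two_pow (Finset.mem_range.1 hj)]
      rfl
    have h1 : ∀ j ∈ Finset.range (2 ^ r), colourExp (r + 1) (2 ^ r + j) = 1 := fun j hj => by
      rw [colourExp, Nat.add_sub_cancel, Nat.testBit_two_pow_add_eq,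
        Nat.testBit_lt_two_pow (Finset.mem_range.1 hj)]
      rfl
    have e0 : ∀ j ∈ Finset.range (2 ^ r),
        C (colour (r + 1) u j) * X ^ colourWeight (r + 1) j =
          C (colour r u j) * X ^ colourWeight r j := fun j hj => by
      rw [colour_succ, colourWeight_succ, h0 j hj, pow_zero, mul_one, add_zero]
    have e1 : ∀ j ∈ Finset.range (2 ^ r),
        C (colour (r + 1) u (2 ^ r + j)) * X ^ colourWeight (r + 1) (2 ^ r + j) =
          C (colour r u j) * X ^ colourWeight r j * (C (u (r + 1)) * X) := fun j hj => by
      rw [colour_succ, colourWeight_succ, h1 j hj, pow_one, colour_two_pow_add,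
        colourWeight_two_pow_add, C_mul, pow_succ, mul_mul_mul_comm]
    have e2 : colourPoly (r + 1) u = colourPoly r u * (1 + C (u (r + 1)) * X) :=
      Finset.prod_Icc_succ_top (by omega) _
    rw [show 2 ^ (r + 1) = 2 ^ r + 2 ^ r by ring, Finset.sum_range_add, Finset.sum_congr rfl e0,
      Finset.sum_congr rfl e1, ← Finset.sum_mul, ih, e2, mul_add, mul_one]

lemma colourWeight_zero (r : ℕ) : colourWeight r 0 = 0 := by
  simp [colourWeight, colourExp]

lemma coeff_colourPoly (r : ℕ) (u : ℕ → ℂ) {k : ℕ} (hk : 1 ≤ k) :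
    (colourPoly r u).coeff k =
      ∑ j ∈ (Finset.Ico 1 (2 ^ r)).filter (fun j => colourWeight r j = k), colour r u j := by
  rw [← sum_colour, finsetSum_coeff, Finset.sum_filter, Finset.range_eq_Ico,
    Finset.sum_eq_sum_Ico_succ_bot (by positivity)]
  simp only [coeff_C_mul, coeff_X_pow, colourWeight_zero, mul_ite, mul_one, mul_zero]
  rw [if_neg (by omega), zero_add]
  exact Finset.sum_congr rfl fun j _ => by simp only [eq_comm]

lemma coeff_zero_colourPoly (r : ℕ) (u : ℕ → ℂ) : (colourPoly r u).coeff 0 = 1 := by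
  rw [coeff_zero_eq_eval_zero, colourPoly, eval_prod]
  simp

lemma eval_colourPoly (r : ℕ) (u : ℕ → ℂ) (x : ℂ) :
    (colourPoly r u).eval x = ∏ k ∈ Finset.Icc 1 r, (1 + u k * x) := by
  simp [colourPoly, eval_prod]

lemma natDegree_colourPoly_le (r : ℕ) (u : ℕ → ℂ) : (colourPoly r u).natDegree ≤ r := by
  refine (natDegree_prod_le _ _).trans ((Finset.sum_le_card_nsmul _ _ 1 fun k _ => ?_).trans ?_)
  · exact (natDegree_add_le _ _).trans
      (max_le (by simp) ((natDegree_C_mul_le _ _).trans natDegree_X_le))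
  · simp

lemma seqQDiff_of_qDiffEq {r : ℕ} (hr : 1 ≤ r) {u : ℕ → ℂ} {d q : ℂ} (hq : ‖q‖ < 1) {D : Set ℂ} {f : ℂ → ℂ}
    (hD : ∀ n : ℕ, q ^ n ∈ D) (hf : QDiffEq r u d q D f) :
    SeqQDiff q d (colourPoly r u) (fun n => f (q ^ n)) := by
  set a : ℕ → ℂ := fun n => f (q ^ n) with ha
  set E := colourPoly r u with hE
  funext n
  have hdeg : E.natDegree ≤ r := natDegree_colourPoly_le r u
  have h1 : aeval (seqOp q 1 d) (divX E) a =
      ∑ k ∈ Finset.range r, E.coeff (k + 1) • (seqOp q 1 d ^ k) a := by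
    have hd' : (divX E).natDegree < r := by
      rw [natDegree_divX_eq_natDegree_tsub_one]
      omega
    rw [aeval_eq_sum_range' hd']
    simp only [LinearMap.sum_apply, LinearMap.smul_apply, coeff_divX]
  have h2 : ∏ i ∈ Finset.Icc 1 r, (1 - d * q ^ n * u i) =
      1 + ∑ k ∈ Finset.range r, E.coeff (k + 1) * (-d * q ^ n) ^ (k + 1) := by
    have : ∏ i ∈ Finset.Icc 1 r, (1 - d * q ^ n * u i) = E.eval (-d * q ^ n) := by
      rw [hE, eval_colourPoly]
      exact Finset.prod_congr rfl fun i _ => by ring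
    rw [this, eval_eq_sum_range' (Nat.lt_succ_of_le hdeg), Finset.sum_range_succ',
      hE, coeff_zero_colourPoly, pow_zero, mul_one, add_comm]
  have h3 := hf (q ^ n) (hD n)
  have h4 : ∀ i ∈ Finset.Icc 1 r, (∑ m ∈ Finset.range (r - i + 1), d ^ m *
        ∑ j ∈ (Finset.Ico 1 (2 ^ r)).filter (fun j => colourWeight r j = i + m),
          q ^ n * colour r u j *
            ((-q ^ n) ^ ((m : ℤ) - 1) * qBinomial q ((i : ℤ) + m - 1) ((m : ℤ) - 1) +
              (-q ^ n) ^ m * qBinomial q ((i : ℤ) + m) (m : ℤ))) *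
            (∏ h ∈ Finset.Icc 1 (i - 1), (1 - q ^ n * q ^ h)) * f (q ^ n * q ^ i) =
      ∑ m ∈ Finset.range (r - i + 1), E.coeff (i + m) * (qDiffCoeff q d (q ^ n) i m *
        ((∏ h ∈ Finset.Icc 1 (i - 1), (1 - q ^ n * q ^ h)) * a (n + i))) := fun i hi => by
    rw [Finset.mem_Icc] at hi
    rw [Finset.sum_mul, Finset.sum_mul]
    refine Finset.sum_congr rfl fun m _ => ?_
    rw [hE, coeff_colourPoly r u (by omega), qDiffCoeff, ← pow_add q n i, ← Finset.sum_mul,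
      ← Finset.mul_sum]
    ring
  rw [Finset.sum_congr rfl h4, h2, ← pow_succ] at h3
  -- Regroup by the weight i + m = k + 1, that is, by powers of W.
  have h5 : ∀ g : ℕ → ℕ → ℂ, ∑ i ∈ Finset.Icc 1 r, ∑ m ∈ Finset.range (r - i + 1), g i m =
      ∑ k ∈ Finset.range r, ∑ i ∈ Finset.range (k + 1), g (i + 1) (k - i) := fun g => by
    rw [Finset.sum_sigma', Finset.sum_sigma']
    refine Finset.sum_nbij' (fun p => ⟨p.1 + p.2 - 1, p.1 - 1⟩)
      (fun p => ⟨p.2 + 1, p.1 - p.2⟩) ?_ ?_ ?_ ?_ ?_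
    · rintro ⟨i, m⟩ h
      simp only [Finset.mem_sigma, Finset.mem_Icc, Finset.mem_range] at h ⊢
      omega
    · rintro ⟨k, i⟩ h
      simp only [Finset.mem_sigma, Finset.mem_Icc, Finset.mem_range] at h ⊢
      omega
    · rintro ⟨i, m⟩ h
      simp only [Finset.mem_sigma, Finset.mem_Icc, Finset.mem_range] at h
      obtain ⟨i, rfl⟩ := Nat.exists_eq_add_of_le' h.1.1
      simp only [Sigma.mk.injEq, heq_eq_eq]
      omega
    · rintro ⟨k, i⟩ h
      simp only [Finset.mem_sigma, Finset.mem_range] at h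
      simp only [Sigma.mk.injEq, heq_eq_eq]
      omega
    · rintro ⟨i, m⟩ h
      simp only [Finset.mem_sigma, Finset.mem_Icc, Finset.mem_range] at h
      obtain ⟨i, rfl⟩ := Nat.exists_eq_add_of_le' h.1.1
      simp only [Nat.add_sub_cancel]
      congr 1
      omega
  rw [h5] at h3
  simp only [Pi.sub_apply, seqShift_apply, seqMulPow_apply, seqShiftAdd_apply, h1,
    Finset.sum_apply, Pi.smul_apply, smul_eq_mul]
  rw [Finset.mul_sum, ← Finset.sum_add_distrib, Finset.mul_sum]
  have h6 : ∀ k ∈ Finset.range r, q ^ n * (E.coeff (k + 1) * (seqOp q 1 d ^ k) a (n + 1) +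
      d * (E.coeff (k + 1) * (seqOp q 1 d ^ k) a n)) =
      ∑ i ∈ Finset.range (k + 1), E.coeff (i + 1 + (k - i)) *
        (qDiffCoeff q d (q ^ n) (i + 1) (k - i) *
        ((∏ h ∈ Finset.Icc 1 (i + 1 - 1), (1 - q ^ n * q ^ h)) * a (n + (i + 1)))) -
      E.coeff (k + 1) * (-d * q ^ n) ^ (k + 1) * a n := fun k _ => by
    have h := seqMulPow_seqShiftAdd_seqOp_pow hq d a k n
    have hs : ∀ i ∈ Finset.range (k + 1), E.coeff (i + 1 + (k - i)) *
        (qDiffCoeff q d (q ^ n) (i + 1) (k - i) *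
        ((∏ h ∈ Finset.Icc 1 (i + 1 - 1), (1 - q ^ n * q ^ h)) * a (n + (i + 1)))) =
        E.coeff (k + 1) * (qDiffCoeff q d (q ^ n) (i + 1) (k - i) *
        ((∏ h ∈ Finset.Icc 1 i, (1 - q ^ n * q ^ h)) * a (n + (i + 1)))) := fun i hi => by
      rw [Finset.mem_range] at hi
      rw [show i + 1 + (k - i) = k + 1 by omega, Nat.add_sub_cancel]
    rw [Finset.sum_congr rfl hs, ← Finset.mul_sum]
    linear_combination E.coeff (k + 1) * h
  rw [Finset.sum_congr rfl h6, Finset.sum_sub_distrib, ← Finset.sum_mul]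
  linear_combination h3

/-! ### Passage to the infinite products -/

lemma qPochhammerInf_ne_zero {a q : ℂ} (hq : ‖q‖ < 1) (h : ∀ n : ℕ, a * q ^ n ≠ 1) :
    qPochhammerInf a q ≠ 0 := by
  have hs : Summable (fun n : ℕ => ‖-(a * q ^ n)‖) := by
    simpa [norm_mul, norm_pow] using
      (summable_geometric_of_lt_one (norm_nonneg q) hq).mul_left ‖a‖
  have := tprod_one_add_ne_zero_of_summable (f := fun n : ℕ => -(a * q ^ n))
    (fun n => by rw [← sub_eq_add_neg]; exact sub_ne_zero.2 (h n).symm) hs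
  simpa [qPochhammerInf, sub_eq_add_neg] using this

theorem theorem3p5 (r : ℕ) (hr : 1 ≤ r) (u : ℕ → ℂ) (d q : ℂ) (hq : ‖q‖ < 1)
    (hd : ∀ k ∈ Finset.Icc 1 r, ∀ n : ℕ, d * u k * q ^ n ≠ 1)
    (D : Set ℂ) (h0D : (0 : ℂ) ∈ D) (h1D : (1 : ℂ) ∈ D) (hqD : ∀ x ∈ D, x * q ∈ D)
    (f : ℂ → ℂ) (hcont : ContinuousWithinAt f D 0) (hf0 : f 0 = 1)
    (hf : QDiffEq r u d q D f) :
    f 1 = ∏ k ∈ Finset.Icc 1 r, qPochhammerInf (-u k) q / qPochhammerInf (d * u k) q := by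
  have hD : ∀ n : ℕ, q ^ n ∈ D := fun n => by
    induction n with
    | zero => simpa using h1D
    | succ n ih => rw [pow_succ]; exact hqD _ ih
  have hlim : Tendsto (fun n : ℕ => f (q ^ n)) atTop (𝓝 1) := by
    have h := hcont.tendsto
    rw [hf0] at h
    exact h.comp (tendsto_nhdsWithin_iff.2
      ⟨tendsto_pow_atTop_nhds_zero_of_norm_lt_one hq, Eventually.of_forall hD⟩)
  have h1 := tendsto_prod_eval hq d (coeff_zero_colourPoly r u) (seqQDiff_of_qDiffEq hr hq hD hf) hlim
  have hprod : ∀ c : ℕ → ℂ, Tendsto (fun K => ∏ n ∈ Finset.range K, ∏ k ∈ Finset.Icc 1 r,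
      (1 - c k * q ^ n)) atTop (𝓝 (∏ k ∈ Finset.Icc 1 r, qPochhammerInf (c k) q)) := fun c => by
    simp_rw [Finset.prod_comm (s := Finset.range _)]
    exact tendsto_finsetProd _ fun k _ =>
      (multipliable_qPochhammerInf (c k) q hq).hasProd.tendsto_prod_nat
  have e1 : ∀ n : ℕ, (colourPoly r u).eval (-d * q ^ n) =
      ∏ k ∈ Finset.Icc 1 r, (1 - d * u k * q ^ n) := fun n => by
    rw [eval_colourPoly]
    exact Finset.prod_congr rfl fun k _ => by ring
  have e2 : ∀ n : ℕ, (colourPoly r u).eval (q ^ n) =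
      ∏ k ∈ Finset.Icc 1 r, (1 - -u k * q ^ n) := fun n => by
    rw [eval_colourPoly]
    exact Finset.prod_congr rfl fun k _ => by ring
  -- Entry 0 of the sequence is f(q^0) = f(1).
  simp only [e1, e2, pow_zero, mul_one] at h1
  have h2 := tendsto_nhds_unique h1
    (((hprod fun k => d * u k).mul_const (f 1)).sub (hprod fun k => -u k))
  have hne : ∏ k ∈ Finset.Icc 1 r, qPochhammerInf (d * u k) q ≠ 0 :=
    Finset.prod_ne_zero_iff.2 fun k hk => qPochhammerInf_ne_zero hq (hd k hk)
  rw [Finset.prod_div_distrib, eq_div_iff hne, mul_comm]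
  exact sub_eq_zero.1 h2.symm
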